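/- Let $\mathcal X$ be a finite set and let $Q:\mathcal X\times\mathcal X\to[0,\infty)$ be transition rates with $Q(x,x)=0$ that are irreducible (any two points are joined by a chain of transitions of positive rate) and reversible with respect to a probability measure $\pi$ on $\mathcal X$, i.e. $Q(x,y)\pi(x)=Q(y,x)\pi(y)$ for all $x,y$. Let $\mathscr P(\mathcal X)=\{\rho:\mathcal X\to[0,\infty) : \sum_x\pi(x)\rho(x)=1\}$ be the set of probability densities with respect to $\pi$, let $\mathcal H(\rho)=\sum_x\pi(x)\rho(x)\log\rho(x)$ (with $0\log 0=0$), and for $\rho\in\mathscr P(\mathcal X)$ put $\hat\rho(x,y)=\theta(\rho(x),\rho(y))$, where $\theta(s,t)=\int_0^1 s^{1-p}t^p\,dp$ is the logarithmic mean. The transport distance $\mathcal W$ is defined by $$\mathcal W(\rho_0,\rho_1)^2=\inf\Big\{\tfrac12\int_0^1\sum_{x,y}(\psi_t(x)-\psi_t(y))^2\,\hat\rho_t(x,y)\,Q(x,y)\,\pi(x)\,dt\Big\},$$ where the infimum is over all absolutely continuous curves $\rho:[0,1]\to\mathscr P(\mathcal X)$ from $\rho_0$ to $\rho_1$ and measurable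 $\psi:[0,1]\to\mathbb R^{\mathcal X}$ such that, for a.e. $t$ and all $x$, $$\frac{d}{dt}\rho_t(x)+\sum_y(\psi_t(y)-\psi_t(x))\,\hat\rho_t(x,y)\,Q(x,y)=0.$$ A constant speed geodesic is a curve $(\rho_t)_{t\in[0,1]}$ in $\mathscr P(\mathcal X)$ with $\mathcal W(\rho_s,\rho_t)=|s-t|\,\mathcal W(\rho_0,\rho_1)$ for all $s,t\in[0,1]$. One says that $\mathrm{Ric}(\mathcal X,Q,\pi)\ge\kappa$ if for every constant speed geodesic $(\rho_t)$ and every $t\in[0,1]$ $$\mathcal H(\rho_t)\le(1-t)\mathcal H(\rho_0)+t\,\mathcal H(\rho_1)-\tfrac{\kappa}{2}\,t(1-t)\,\mathcal W(\rho_0,\rho_1)^2 .$$ Finally let $d_{\mathcal W}(x,y)=\mathcal W(\delta_x,\delta_y)$, where the Dirac mass at $x$ is identified with its density $\mathbf 1_{\{x\}}/\pi(x)$. **Proposition (discrete Bonnet–Myers theorem).** Let $\kappa>0$ and suppose that $\mathrm{Ric}(\mathcal X,Q,\pi)\ge\kappa$. Then for all $x,y\in\mathcal X$ $$d_{\mathcal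 W}(x,y)\le 2\sqrt{\frac{-\log\pi(x)-\log\pi(y)}{\kappa}} .$$ Consequently the diameter of $(\mathcal X,d_{\mathcal W})$ is at most $2\sqrt{-2\log\pi_*/\kappa}$, where $\pi_*=\inf\{\pi(x):x\in\mathcal X\}$. -/

import Mathlib

open MeasureTheory Set
open scoped ENNReal BigOperators

/-- The logarithmic mean `θ(s,t) = ∫₀¹ s^(1-p) t^p dp` of `s, t ≥ 0`. -/
noncomputable def logMean (s t : ℝ) : ℝ :=
  ∫ p in (0 : ℝ)..1, s ^ (1 - p) * t ^ p

/-- A finite, irreducible continuous-time Markov chain with transition rates `Q`, together with a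
probability measure `pi` (given by its point masses) with respect to which it is reversible. -/
structure MarkovTriple (X : Type*) [Fintype X] where
  /-- transition rates -/
  Q : X → X → ℝ
  /-- point masses of the reversible probability measure -/
  pi : X → ℝ
  Q_nonneg : ∀ x y, 0 ≤ Q x y
  Q_self : ∀ x, Q x x = 0
  irreducible : ∀ x y, Relation.ReflTransGen (fun a b => 0 < Q a b) x y
  pi_nonneg : ∀ x, 0 ≤ pi x
  pi_sum : ∑ x, pi x = 1
  detailed_balance : ∀ x y, Q x y * pi x = Q y x * pi y

namespace MarkovTriple

variable {X : Type*} [Fintype X] (M : MarkovTriple X)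

/-- The set of probability densities with respect to `pi`. -/
def densities : Set (X → ℝ) :=
  {ρ | (∀ x, 0 ≤ ρ x) ∧ ∑ x, M.pi x * ρ x = 1}

/-- `(ρ, ψ)` solves the continuity equation on `[0,1]` and connects `ρ₀` to `ρ₁`: `ρ` is an
absolutely continuous curve of probability densities, `ψ` is measurable, and
`d/dt ρ_t(x) + ∑_y (ψ_t(y) - ψ_t(x)) θ(ρ_t(x), ρ_t(y)) Q(x,y) = 0` for a.e. `t` and all `x`.
Only the values at times in `[0,1]` matter. -/
structure SolvesContinuityEq (ρ₀ ρ₁ : X → ℝ) (ρ ψ : ℝ → X → ℝ) : Prop where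
  mem_densities : ∀ t ∈ Icc (0 : ℝ) 1, ρ t ∈ M.densities
  absolutelyContinuous : ∀ x, AbsolutelyContinuousOnInterval (fun t => ρ t x) 0 1
  measurable : Measurable ψ
  equation : ∀ᵐ t ∂(volume.restrict (Icc (0 : ℝ) 1)), ∀ x,
    HasDerivAt (fun s => ρ s x)
      (-∑ y, (ψ t y - ψ t x) * logMean (ρ t x) (ρ t y) * M.Q x y) t
  initial : ρ 0 = ρ₀
  final : ρ 1 = ρ₁

/-- The action `½ ∫₀¹ ∑_{x,y} (ψ_t(x) - ψ_t(y))² θ(ρ_t(x), ρ_t(y)) Q(x,y) π(x) dt ∈ [0,∞]`. -/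
noncomputable def action (ρ ψ : ℝ → X → ℝ) : ℝ≥0∞ :=
  ∫⁻ t in Icc (0 : ℝ) 1, ENNReal.ofReal
    ((1 / 2) * ∑ x, ∑ y, (ψ t x - ψ t y) ^ 2 * logMean (ρ t x) (ρ t y) * M.Q x y * M.pi x)

/-- The discrete transport distance `𝒲`: the square root of the infimum of the action over all
solutions of the continuity equation connecting `ρ₀` to `ρ₁`. -/
noncomputable def W (ρ₀ ρ₁ : X → ℝ) : ℝ≥0∞ :=
  (⨅ (ρ : ℝ → X → ℝ) (ψ : ℝ → X → ℝ) (_ : M.SolvesContinuityEq ρ₀ ρ₁ ρ ψ), M.action ρ ψ)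
    ^ (1 / 2 : ℝ)

/-- The relative entropy `ℋ(ρ) = ∑_x π(x) ρ(x) log ρ(x)`, with `0 log 0 = 0`. -/
noncomputable def entropy (ρ : X → ℝ) : ℝ :=
  ∑ x, M.pi x * (ρ x * Real.log (ρ x))

/-- Constant speed geodesics `(ρ_t)`, `t ∈ [0,1]`, in the space of densities with the metric `𝒲`. -/
def IsConstantSpeedGeodesic (ρ : ℝ → X → ℝ) : Prop :=
  (∀ t ∈ Icc (0 : ℝ) 1, ρ t ∈ M.densities) ∧
    ∀ s ∈ Icc (0 : ℝ) 1, ∀ t ∈ Icc (0 : ℝ) 1,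
      M.W (ρ s) (ρ t) = ENNReal.ofReal |s - t| * M.W (ρ 0) (ρ 1)

/-- The entropic Ricci curvature is bounded from below by `κ`. -/
def RicciBoundedBelow (κ : ℝ) : Prop :=
  ∀ ρ : ℝ → X → ℝ, M.IsConstantSpeedGeodesic ρ → ∀ t ∈ Icc (0 : ℝ) 1,
    M.entropy (ρ t) ≤ (1 - t) * M.entropy (ρ 0) + t * M.entropy (ρ 1)
      - κ / 2 * t * (1 - t) * (M.W (ρ 0) (ρ 1)).toReal ^ 2

/-- The density with respect to `pi` of the Dirac mass at `x`. -/
noncomputable def diracDensity (x : X) : X → ℝ :=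
  Set.indicator {x} fun _ => 1 / M.pi x

/-- The distance `d_𝒲(x,y) = 𝒲(δ_x, δ_y)` on the state space. -/
noncomputable def dW (x y : X) : ℝ≥0∞ :=
  M.W (M.diracDensity x) (M.diracDensity y)

/-- The diameter of the state space with respect to `d_𝒲`. -/
noncomputable def diamW : ℝ≥0∞ :=
  ⨆ (x : X) (y : X), M.dW x y

/-- The minimal mass `π_* = inf_x π(x)`. -/
noncomputable def piMin : ℝ :=
  ⨅ x, M.pi x

end MarkovTriple

/-!
Let `ρ_t` be a constant speed geodesic from `δ_x` to `δ_y`. The curvature bound at `t = 1/2` reads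
`ℋ(ρ_{1/2}) ≤ (ℋ(δ_x) + ℋ(δ_y)) / 2 - (κ / 8) 𝒲(δ_x, δ_y)²`. The left-hand side is nonnegative by
Jensen's inequality and `ℋ(δ_x) = -log π(x)`, so the bound on `𝒲(δ_x, δ_y)` follows, provided that
this distance is finite and that the geodesic exists.

Both come from one estimate. If `ρ₁ ≥ m > 0`, the curve `ρ₀ + t² (ρ₁ - ρ₀)`, driven by the
potential obtained by inverting the weighted Laplacian, has action at most a constant times
`‖ρ₁ - ρ₀‖² / m` (`MarkovTriple.W_sq_le_of_pos`): the square in the time parameter compensates the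
degeneracy of the logarithmic mean where `ρ₀` vanishes. Mixing with the constant density `1` then
shows that `𝒲` is finite and Hölder continuous of exponent `1/2` with respect to the norm of
`X → ℝ` (`MarkovTriple.exists_W_le_sqrt`); together with the triangle inequality, `𝒲` is
continuous on the compact set of densities.

Given continuity, no compactness for the potentials is needed. Near-optimal curves converge
pointwise along an ultrafilter, and only inequalities between the distances of points on them have
to pass to the limit. Cutting a curve of action `A` at times `s ≤ t` and rescaling the pieces gives
`𝒲(ρ_s, ρ_t)² ≤ (t - s) A_{[s,t]}`, and likewise for the other pieces; since the pieces of action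
add up to `A`, which tends to `𝒲(ρ₀, ρ₁)²`, the triangle inequality forces
`𝒲(ρ_s, ρ_t) = (t - s) 𝒲(ρ₀, ρ₁)` in the limit (`MarkovTriple.exists_isConstantSpeedGeodesic`).
-/

/-! ### The logarithmic mean -/

theorem logMean_comm (s t : ℝ) : logMean s t = logMean t s := by
  have h := intervalIntegral.integral_comp_sub_left (a := 0) (b := 1)
    (fun p : ℝ => t ^ (1 - p) * s ^ p) 1
  simp only [sub_sub_cancel, sub_self, sub_zero] at h
  unfold logMean
  rw [← h]
  simp_rw [mul_comm]

theorem le_logMean {m s t : ℝ} (hm : 0 < m) (hs : m ≤ s) (ht : m ≤ t) : m ≤ logMean s t := by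
  have hs0 : 0 < s := hm.trans_le hs
  have ht0 : 0 < t := hm.trans_le ht
  have hcont : Continuous fun p : ℝ => s ^ (1 - p) * t ^ p :=
    (continuous_const.rpow (by fun_prop) fun _ => Or.inl hs0.ne').mul
      (continuous_const.rpow continuous_id fun _ => Or.inl ht0.ne')
  have hint : ∫ _ in (0 : ℝ)..1, m ≤ logMean s t := by
    refine intervalIntegral.integral_mono_on zero_le_one intervalIntegrable_const
      (hcont.intervalIntegrable _ _) fun p hp => ?_
    calc m = m ^ (1 - p) * m ^ p := by
          rw [← Real.rpow_add hm, sub_add_cancel, Real.rpow_one]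
      _ ≤ s ^ (1 - p) * t ^ p := by
          have h1 : 0 ≤ 1 - p := by linarith [hp.2]
          have h2 : 0 ≤ p := hp.1
          gcongr
  simpa using hint

theorem measurable_logMean : Measurable fun q : ℝ × ℝ => logMean q.1 q.2 := by
  unfold logMean
  simp_rw [intervalIntegral.integral_of_le (zero_le_one' ℝ)]
  refine StronglyMeasurable.measurable (StronglyMeasurable.integral_prod_right'
    (f := fun z : (ℝ × ℝ) × ℝ => z.1.1 ^ (1 - z.2) * z.1.2 ^ z.2) ?_)
  exact Measurable.stronglyMeasurable (by fun_prop)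

/-! ### Absolutely continuous functions under change of variable and concatenation -/

namespace AbsolutelyContinuousOnInterval

theorem disjoint_uIoc_iff {x y x' y' : ℝ} :
    Disjoint (uIoc x y) (uIoc x' y') ↔ min (max x y) (max x' y') ≤ max (min x y) (min x' y') :=
  Set.Ioc_disjoint_Ioc

/-- Monotone and antitone maps send disjoint intervals to disjoint intervals, so a Lipschitz
such map may be substituted into an absolutely continuous function. -/
theorem comp_of_monotone_or_antitone {f φ : ℝ → ℝ} {a b c d K : ℝ}
    (hf : AbsolutelyContinuousOnInterval f a b) (hφ : Monotone φ ∨ Antitone φ)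
    (hK : ∀ x y, dist (φ x) (φ y) ≤ K * dist x y)
    (hmaps : MapsTo φ (uIcc c d) (uIcc a b)) :
    AbsolutelyContinuousOnInterval (fun t => f (φ t)) c d := by
  rw [absolutelyContinuousOnInterval_iff] at hf ⊢
  intro ε hε
  obtain ⟨δ, hδ, H⟩ := hf ε hε
  refine ⟨δ / (|K| + 1), by positivity, fun E hE hlen => ?_⟩
  refine H (E.1, fun i => (φ (E.2 i).1, φ (E.2 i).2)) ⟨fun i hi => ?_, fun i hi j hj hij => ?_⟩ ?_
  · exact ⟨hmaps (hE.1 i hi).1, hmaps (hE.1 i hi).2⟩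
  · have h := hE.2 hi hj hij
    simp only [Function.onFun] at h ⊢
    rw [disjoint_uIoc_iff] at h ⊢
    rcases hφ with hφ | hφ
    · simpa only [hφ.map_min, hφ.map_max] using hφ h
    · simpa only [hφ.map_min, hφ.map_max] using hφ h
  · calc ∑ i ∈ Finset.range E.1, dist (φ (E.2 i).1) (φ (E.2 i).2)
        ≤ ∑ i ∈ Finset.range E.1, (|K| + 1) * dist (E.2 i).1 (E.2 i).2 := by
          refine Finset.sum_le_sum fun i _ => (hK _ _).trans ?_
          gcongr
          linarith [le_abs_self K]
      _ = (|K| + 1) * ∑ i ∈ Finset.range E.1, dist (E.2 i).1 (E.2 i).2 :=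
          (Finset.mul_sum _ _ _).symm
      _ < (|K| + 1) * (δ / (|K| + 1)) := by gcongr
      _ = δ := by field_simp

theorem comp_mul_add {f : ℝ → ℝ} {a b c d : ℝ}
    (hf : AbsolutelyContinuousOnInterval f (c * a + d) (c * b + d)) :
    AbsolutelyContinuousOnInterval (fun t => f (c * t + d)) a b := by
  refine hf.comp_of_monotone_or_antitone (φ := fun t => c * t + d) (K := |c|) ?_ ?_ ?_
  · rcases le_total 0 c with hc | hc
    · exact Or.inl fun x y h => by simp only; gcongr
    · exact Or.inr fun x y h => by simpa using mul_le_mul_of_nonpos_left h hc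
  · intro x y
    rw [Real.dist_eq, Real.dist_eq, ← abs_mul]
    apply le_of_eq
    congr 1
    ring
  · intro t ht
    have h : c * t + d ∈ (fun x => x + d) '' ((fun x => c * x) '' uIcc a b) :=
      ⟨c * t, ⟨t, ht, rfl⟩, rfl⟩
    rwa [image_const_mul_uIcc, image_add_const_uIcc] at h

/-- The concatenation is `f (min t b) + g (max t b) - f b`. -/
theorem ite_le {f g : ℝ → ℝ} {a b c : ℝ} (hab : a ≤ b) (hbc : b ≤ c)
    (hf : AbsolutelyContinuousOnInterval f a b) (hg : AbsolutelyContinuousOnInterval g b c)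
    (h : f b = g b) :
    AbsolutelyContinuousOnInterval (fun t => if t ≤ b then f t else g t) a c := by
  have h1 : AbsolutelyContinuousOnInterval (fun t => f (min t b)) a c := by
    refine hf.comp_of_monotone_or_antitone (φ := fun t => min t b) (K := 1)
      (Or.inl fun x y h => min_le_min_right b h) (fun x y => ?_) fun t ht => ?_
    · simpa [Real.dist_eq] using abs_min_sub_min_le_max x b y b
    · rw [uIcc_of_le (hab.trans hbc)] at ht
      rw [uIcc_of_le hab]
      exact ⟨le_min ht.1 hab, min_le_right _ _⟩
  have h2 : AbsolutelyContinuousOnInterval (fun t => g (max t b)) a c := by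
    refine hg.comp_of_monotone_or_antitone (φ := fun t => max t b) (K := 1)
      (Or.inl fun x y h => max_le_max_right b h) (fun x y => ?_) fun t ht => ?_
    · simpa [Real.dist_eq] using abs_max_sub_max_le_max x b y b
    · rw [uIcc_of_le (hab.trans hbc)] at ht
      rw [uIcc_of_le hbc]
      exact ⟨le_max_right _ _, max_le ht.2 hbc⟩
  have h3 : AbsolutelyContinuousOnInterval (fun _ => f b) a c :=
    contDiff_const.contDiffOn.absolutelyContinuousOnInterval
  have heq : (fun t => if t ≤ b then f t else g t) =
      fun t => f (min t b) + g (max t b) - f b := by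
    funext t
    split_ifs with ht
    · rw [min_eq_left ht, max_eq_right ht, h]; ring
    · rw [min_eq_right (not_le.1 ht).le, max_eq_left (not_le.1 ht).le]; ring
  rw [heq]
  exact (h1.fun_add h2).fun_sub h3

end AbsolutelyContinuousOnInterval

namespace MarkovTriple

variable {X : Type*} [Fintype X] (M : MarkovTriple X)

/-! ### The continuity equation on an arbitrary interval -/

/-- The integrand of the action: the Dirichlet form of `ψ` with conductances weighted by `ρ`. -/
noncomputable def energy (ρ ψ : X → ℝ) : ℝ :=
  (1 / 2) * ∑ x, ∑ y, (ψ x - ψ y) ^ 2 * logMean (ρ x) (ρ y) * M.Q x y * M.pi x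

/-- `(ρ, ψ)` solves the continuity equation on the interval with endpoints `a` and `b`, in either
order. -/
structure FlowOn (a b : ℝ) (ρ ψ : ℝ → X → ℝ) : Prop where
  mem_densities : ∀ t ∈ uIcc a b, ρ t ∈ M.densities
  absolutelyContinuous : ∀ x, AbsolutelyContinuousOnInterval (fun t => ρ t x) a b
  measurable : Measurable ψ
  equation : ∀ᵐ t, t ∈ uIcc a b → ∀ x, HasDerivAt (fun s => ρ s x)
    (-∑ y, (ψ t y - ψ t x) * logMean (ρ t x) (ρ t y) * M.Q x y) t

/-- The action of a flow over the interval with endpoints `a` and `b`. -/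
noncomputable def actionOn (a b : ℝ) (ρ ψ : ℝ → X → ℝ) : ℝ≥0∞ :=
  ∫⁻ t in uIcc a b, ENNReal.ofReal (M.energy (ρ t) (ψ t))

variable {M}

theorem action_eq_actionOn (ρ ψ : ℝ → X → ℝ) : M.action ρ ψ = M.actionOn 0 1 ρ ψ := by
  rw [action, actionOn, uIcc_of_le zero_le_one]
  rfl

theorem solvesContinuityEq_iff {σ τ : X → ℝ} {ρ ψ : ℝ → X → ℝ} :
    M.SolvesContinuityEq σ τ ρ ψ ↔ M.FlowOn 0 1 ρ ψ ∧ ρ 0 = σ ∧ ρ 1 = τ := by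
  have hu : uIcc (0 : ℝ) 1 = Icc 0 1 := uIcc_of_le zero_le_one
  constructor
  · intro h
    exact ⟨⟨hu ▸ h.mem_densities, h.absolutelyContinuous, h.measurable,
      hu ▸ (ae_restrict_iff' measurableSet_Icc).1 h.equation⟩, h.initial, h.final⟩
  · rintro ⟨h, h0, h1⟩
    exact ⟨hu ▸ h.mem_densities, h.absolutelyContinuous, h.measurable,
      (ae_restrict_iff' measurableSet_Icc).2 (hu ▸ h.equation), h0, h1⟩

namespace FlowOn

theorem symm {a b : ℝ} {ρ ψ : ℝ → X → ℝ} (h : M.FlowOn a b ρ ψ) : M.FlowOn b a ρ ψ :=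
  ⟨uIcc_comm a b ▸ h.mem_densities, fun x => (h.absolutelyContinuous x).symm, h.measurable,
    uIcc_comm a b ▸ h.equation⟩

theorem mono {a b c d : ℝ} {ρ ψ : ℝ → X → ℝ} (h : M.FlowOn a b ρ ψ)
    (hs : uIcc c d ⊆ uIcc a b) : M.FlowOn c d ρ ψ :=
  ⟨fun t ht => h.mem_densities t (hs ht), fun x => (h.absolutelyContinuous x).mono hs,
    h.measurable, h.equation.mono fun _ H ht => H (hs ht)⟩

theorem image_affine_uIcc (a b c d : ℝ) :
    (fun t => c * t + d) '' uIcc a b = uIcc (c * a + d) (c * b + d) := by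
  rw [← image_add_const_uIcc, ← image_const_mul_uIcc, image_image]

theorem comp_affine {a b c d : ℝ} {ρ ψ : ℝ → X → ℝ} (hc : c ≠ 0)
    (h : M.FlowOn (c * a + d) (c * b + d) ρ ψ) :
    M.FlowOn a b (fun t => ρ (c * t + d)) (fun t => c • ψ (c * t + d)) := by
  have hmaps : ∀ t ∈ uIcc a b, c * t + d ∈ uIcc (c * a + d) (c * b + d) := fun t ht =>
    image_affine_uIcc a b c d ▸ mem_image_of_mem _ ht
  have hq : Measure.QuasiMeasurePreserving (fun t : ℝ => c * t + d) volume volume := by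
    refine (measurePreserving_add_right volume d).quasiMeasurePreserving.comp
      (g := fun t : ℝ => t + d) (f := fun t => c * t) ⟨by fun_prop, ?_⟩
    rw [Real.map_volume_mul_left hc]
    exact Measure.smul_absolutelyContinuous
  refine ⟨fun t ht => h.mem_densities _ (hmaps t ht),
    fun x => (h.absolutelyContinuous x).comp_mul_add,
    (h.measurable.comp (by fun_prop : Measurable fun t : ℝ => c * t + d)).const_smul c, ?_⟩
  filter_upwards [hq.ae h.equation] with t ht htm x
  have hd : HasDerivAt (fun s : ℝ => c * s + d) c t := by
    simpa using ((hasDerivAt_id t).const_mul c).add_const d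
  have := (ht (hmaps t htm) x).comp t hd
  refine this.congr_deriv ?_
  rw [neg_mul, Finset.sum_mul]
  congr 1
  refine Finset.sum_congr rfl fun y _ => ?_
  simp only [Pi.smul_apply, smul_eq_mul]
  ring

theorem energy_smul (c : ℝ) (ρ ψ : X → ℝ) :
    M.energy ρ (c • ψ) = c ^ 2 * M.energy ρ ψ := by
  unfold energy
  simp only [Pi.smul_apply, smul_eq_mul, Finset.mul_sum]
  refine Finset.sum_congr rfl fun x _ => Finset.sum_congr rfl fun y _ => ?_
  ring

/-- A change of speed by the factor `c` multiplies the energy by `c²` and the length of the time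
interval by `1/|c|`. -/
theorem actionOn_comp_affine {a b c d : ℝ} (ρ ψ : ℝ → X → ℝ) (hc : c ≠ 0) :
    M.actionOn a b (fun t => ρ (c * t + d)) (fun t => c • ψ (c * t + d)) =
      ENNReal.ofReal |c| * M.actionOn (c * a + d) (c * b + d) ρ ψ := by
  unfold actionOn
  rw [← image_affine_uIcc, lintegral_image_eq_lintegral_abs_deriv_mul measurableSet_uIcc
    (f' := fun _ => c), ← lintegral_const_mul' _ _ ENNReal.ofReal_ne_top]
  · refine lintegral_congr fun t => ?_
    rw [energy_smul, ← mul_assoc, ENNReal.ofReal_mul (sq_nonneg c), ← ENNReal.ofReal_mul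
      (abs_nonneg c), abs_mul_abs_self, sq]
  · intro t _
    simpa using (((hasDerivAt_id t).const_mul c).add_const d).hasDerivWithinAt
  · intro x _ y _ hxy
    simpa [hc] using hxy

theorem actionOn_add {a b c : ℝ} (hab : a ≤ b) (hbc : b ≤ c) (ρ ψ : ℝ → X → ℝ) :
    M.actionOn a b ρ ψ + M.actionOn b c ρ ψ = M.actionOn a c ρ ψ := by
  unfold actionOn
  rw [uIcc_of_le hab, uIcc_of_le hbc, uIcc_of_le (hab.trans hbc),
    setLIntegral_congr (Ioc_ae_eq_Icc (a := b) (b := c)).symm,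
    ← lintegral_union measurableSet_Ioc, Icc_union_Ioc_eq_Icc hab hbc]
  rw [Set.disjoint_left]
  exact fun t h1 h2 => not_le.2 h2.1 h1.2

theorem concat {a b c : ℝ} {ρ₁ ψ₁ ρ₂ ψ₂ : ℝ → X → ℝ} (hab : a ≤ b) (hbc : b ≤ c)
    (h₁ : M.FlowOn a b ρ₁ ψ₁) (h₂ : M.FlowOn b c ρ₂ ψ₂) (h : ρ₁ b = ρ₂ b) :
    M.FlowOn a c (fun t => if t ≤ b then ρ₁ t else ρ₂ t)
      (fun t => if t ≤ b then ψ₁ t else ψ₂ t) := by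
  have hac := hab.trans hbc
  refine ⟨fun t ht => ?_, fun x => ?_, h₁.measurable.ite measurableSet_Iic h₂.measurable, ?_⟩
  · rw [uIcc_of_le hac] at ht
    split_ifs with htb
    · exact h₁.mem_densities t (by rw [uIcc_of_le hab]; exact ⟨ht.1, htb⟩)
    · exact h₂.mem_densities t (by rw [uIcc_of_le hbc]; exact ⟨(not_le.1 htb).le, ht.2⟩)
  · have := (h₁.absolutelyContinuous x).ite_le hab hbc (h₂.absolutelyContinuous x)
      (congrFun h x)
    convert this using 2 with t
    split_ifs <;> rfl
  -- Away from the null set `{b}` the concatenation locally agrees with one of the two flows.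
  · filter_upwards [h₁.equation, h₂.equation, Measure.ae_ne volume b] with t e₁ e₂ htb htac x
    rw [uIcc_of_le hac] at htac
    rcases lt_or_gt_of_ne htb with hlt | hgt
    · simp only [if_pos hlt.le]
      refine (e₁ (by rw [uIcc_of_le hab]; exact ⟨htac.1, hlt.le⟩) x).congr_of_eventuallyEq ?_
      filter_upwards [Iio_mem_nhds hlt] with s hs
      rw [if_pos (le_of_lt hs)]
    · simp only [if_neg (not_le.2 hgt)]
      refine (e₂ (by rw [uIcc_of_le hbc]; exact ⟨hgt.le, htac.2⟩) x).congr_of_eventuallyEq ?_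
      filter_upwards [Ioi_mem_nhds hgt] with s hs
      rw [if_neg (not_le.2 hs)]

theorem actionOn_concat {a b c : ℝ} {ρ₁ ψ₁ ρ₂ ψ₂ : ℝ → X → ℝ} (hab : a ≤ b) (hbc : b ≤ c) :
    M.actionOn a c (fun t => if t ≤ b then ρ₁ t else ρ₂ t)
      (fun t => if t ≤ b then ψ₁ t else ψ₂ t) =
    M.actionOn a b ρ₁ ψ₁ + M.actionOn b c ρ₂ ψ₂ := by
  rw [← actionOn_add hab hbc]
  unfold actionOn
  congr 1
  · refine setLIntegral_congr_fun measurableSet_Icc fun t ht => ?_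
    rw [uIcc_of_le hab] at ht
    simp only [if_pos ht.2]
  · rw [uIcc_of_le hbc, setLIntegral_congr (Ioc_ae_eq_Icc (a := b) (b := c)).symm,
      setLIntegral_congr (Ioc_ae_eq_Icc (a := b) (b := c)).symm]
    refine setLIntegral_congr_fun measurableSet_Ioc fun t ht => ?_
    simp only [if_neg (not_le.2 ht.1)]

end FlowOn

/-! ### Elementary properties of the transport distance -/

theorem W_sq (σ τ : X → ℝ) : M.W σ τ ^ 2 =
    ⨅ (ρ : ℝ → X → ℝ) (ψ : ℝ → X → ℝ) (_ : M.SolvesContinuityEq σ τ ρ ψ), M.action ρ ψ := by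
  rw [W, ← ENNReal.rpow_natCast, ← ENNReal.rpow_mul]
  norm_num

theorem W_sq_le_action {σ τ : X → ℝ} {ρ ψ : ℝ → X → ℝ} (h : M.SolvesContinuityEq σ τ ρ ψ) :
    M.W σ τ ^ 2 ≤ M.action ρ ψ := by
  rw [W_sq]
  exact iInf_le_of_le ρ (iInf_le_of_le ψ (iInf_le _ h))

theorem W_self {σ : X → ℝ} (hσ : σ ∈ M.densities) : M.W σ σ = 0 := by
  have h : M.SolvesContinuityEq σ σ (fun _ => σ) (fun _ => 0) := by
    refine ⟨fun _ _ => hσ, fun x => contDiff_const.contDiffOn.absolutelyContinuousOnInterval,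
      measurable_const, ?_, rfl, rfl⟩
    filter_upwards with t x
    simpa using hasDerivAt_const t (σ x)
  have h2 := W_sq_le_action h
  simpa [action] using h2

theorem FlowOn.W_sq_le {a b : ℝ} {ρ ψ : ℝ → X → ℝ} (hab : a ≤ b) (h : M.FlowOn a b ρ ψ) :
    M.W (ρ a) (ρ b) ^ 2 ≤ ENNReal.ofReal (b - a) * M.actionOn a b ρ ψ := by
  rcases hab.eq_or_lt with rfl | hlt
  · simp [W_self (h.mem_densities a left_mem_uIcc)]
  have hc : 0 < b - a := sub_pos.2 hlt
  have h0 : (b - a) * 0 + a = a := by ring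
  have h1 : (b - a) * 1 + a = b := by ring
  have hf := FlowOn.comp_affine (a := 0) (b := 1) (c := b - a) (d := a) (ρ := ρ) (ψ := ψ) hc.ne'
    (by rwa [h0, h1])
  have hW := W_sq_le_action (solvesContinuityEq_iff.2 ⟨hf, rfl, rfl⟩)
  rw [action_eq_actionOn, FlowOn.actionOn_comp_affine ρ ψ hc.ne'] at hW
  simpa only [h0, h1, abs_of_pos hc] using hW

theorem exists_flowOn {a b : ℝ} {σ τ : X → ℝ} {A : ℝ≥0∞} (hab : a < b) (h : M.W σ τ ^ 2 < A) :
    ∃ ρ ψ, M.FlowOn a b ρ ψ ∧ ρ a = σ ∧ ρ b = τ ∧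
      M.actionOn a b ρ ψ ≤ ENNReal.ofReal (1 / (b - a)) * A := by
  rw [W_sq] at h
  simp only [iInf_lt_iff] at h
  obtain ⟨ρ, ψ, hs, hA⟩ := h
  obtain ⟨hf, h0, h1⟩ := solvesContinuityEq_iff.1 hs
  have hc : 0 < b - a := sub_pos.2 hab
  have hc' : 0 < 1 / (b - a) := one_div_pos.2 hc
  have ha : 1 / (b - a) * a + -a / (b - a) = 0 := by field_simp; ring
  have hb : 1 / (b - a) * b + -a / (b - a) = 1 := by field_simp; ring
  refine ⟨_, _, FlowOn.comp_affine (d := -a / (b - a)) (ρ := ρ) (ψ := ψ) hc'.ne'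
    (by rwa [ha, hb]), by simp only [ha, h0], by simp only [hb, h1], ?_⟩
  rw [FlowOn.actionOn_comp_affine ρ ψ hc'.ne', ha, hb, abs_of_pos hc', ← action_eq_actionOn]
  gcongr

theorem W_comm (σ τ : X → ℝ) : M.W σ τ = M.W τ σ := by
  suffices H : ∀ σ τ : X → ℝ, M.W σ τ ^ 2 ≤ M.W τ σ ^ 2 by
    have h := le_antisymm (H σ τ) (H τ σ)
    exact (ENNReal.pow_right_strictMono two_ne_zero).injective h
  intro σ τ
  rw [W_sq τ σ]
  refine le_iInf fun ρ => le_iInf fun ψ => le_iInf fun h => ?_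
  obtain ⟨hf, h0, h1⟩ := solvesContinuityEq_iff.1 h
  have hf' : M.FlowOn 0 1 (fun t => ρ (-1 * t + 1)) (fun t => (-1 : ℝ) • ψ (-1 * t + 1)) :=
    FlowOn.comp_affine (by norm_num) (by simpa using hf.symm)
  refine (W_sq_le_action (solvesContinuityEq_iff.2
    ⟨hf', by simpa using h1, by simpa using h0⟩)).trans (le_of_eq ?_)
  rw [action_eq_actionOn, action_eq_actionOn, FlowOn.actionOn_comp_affine ρ ψ (by norm_num)]
  unfold actionOn
  norm_num [uIcc_comm]

/-- Concatenating two flows run during the time fractions `θ` and `1 - θ`. -/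
theorem W_sq_le_concat {ρ σ τ : X → ℝ} {A B θ : ℝ} (hθ : 0 < θ) (hθ' : θ < 1) (hB : 0 ≤ B)
    (hρσ : M.W ρ σ ^ 2 < ENNReal.ofReal A) (hστ : M.W σ τ ^ 2 < ENNReal.ofReal B) :
    M.W ρ τ ^ 2 ≤ ENNReal.ofReal (A / θ + B / (1 - θ)) := by
  have hA : 0 ≤ A := (ENNReal.ofReal_pos.1 (pos_of_gt hρσ)).le
  obtain ⟨ρ₁, ψ₁, f₁, s₁, e₁, A₁⟩ := exists_flowOn hθ hρσ
  obtain ⟨ρ₂, ψ₂, f₂, s₂, e₂, A₂⟩ := exists_flowOn hθ' hστ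
  have h := (f₁.concat hθ.le hθ'.le f₂ (e₁.trans s₂.symm)).W_sq_le zero_le_one
  rw [FlowOn.actionOn_concat hθ.le hθ'.le] at h
  simp only [hθ.le, if_true, not_le.2 hθ', if_false, s₁, e₂, sub_zero, ENNReal.ofReal_one,
    one_mul] at h
  refine h.trans ((add_le_add A₁ A₂).trans (le_of_eq ?_))
  have h1 : 0 < 1 - θ := sub_pos.2 hθ'
  rw [← ENNReal.ofReal_mul (by simp [hθ.le]), ← ENNReal.ofReal_mul (by positivity),
    ← ENNReal.ofReal_add (by simp only [sub_zero]; positivity) (by positivity)]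
  congr 1
  rw [sub_zero]
  ring

/-- With `x`, `y` slightly above the two distances, the time fraction `x / (x + y)` turns the
bound `x²/θ + y²/(1-θ)` into `(x + y)²`. -/
theorem W_triangle (ρ σ τ : X → ℝ) : M.W ρ τ ≤ M.W ρ σ + M.W σ τ := by
  rcases eq_or_ne (M.W ρ σ) ⊤ with h₁ | h₁
  · simp [h₁]
  rcases eq_or_ne (M.W σ τ) ⊤ with h₂ | h₂
  · simp [h₂]
  set x := (M.W ρ σ).toReal with hx
  set y := (M.W σ τ).toReal with hy
  have hx0 : 0 ≤ x := ENNReal.toReal_nonneg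
  have hy0 : 0 ≤ y := ENNReal.toReal_nonneg
  have ex : M.W ρ σ = ENNReal.ofReal x := (ENNReal.ofReal_toReal h₁).symm
  have ey : M.W σ τ = ENNReal.ofReal y := (ENNReal.ofReal_toReal h₂).symm
  rw [ex, ey, ← ENNReal.ofReal_add hx0 hy0]
  have key : ∀ δ : ℝ, 0 < δ → M.W ρ τ ≤ ENNReal.ofReal (x + y + δ) := by
    intro δ hδ
    have hxp : 0 < x + δ / 2 := by positivity
    have hyp : 0 < y + δ / 2 := by positivity
    have h := W_sq_le_concat (M := M) (ρ := ρ) (σ := σ) (τ := τ) (A := (x + δ / 2) ^ 2)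
      (B := (y + δ / 2) ^ 2) (θ := (x + δ / 2) / (x + y + δ)) (by positivity)
      (by rw [div_lt_one (by positivity)]; linarith) (by positivity)
      (by rw [ex, ← ENNReal.ofReal_pow hx0]
          exact (ENNReal.ofReal_lt_ofReal_iff (by positivity)).2 (by gcongr; linarith))
      (by rw [ey, ← ENNReal.ofReal_pow hy0]
          exact (ENNReal.ofReal_lt_ofReal_iff (by positivity)).2 (by gcongr; linarith))
    have e : (x + δ / 2) ^ 2 / ((x + δ / 2) / (x + y + δ)) +
        (y + δ / 2) ^ 2 / (1 - (x + δ / 2) / (x + y + δ)) = (x + y + δ) ^ 2 := by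
      have h3 : 1 - (x + δ / 2) / (x + y + δ) = (y + δ / 2) / (x + y + δ) := by
        rw [eq_div_iff (by positivity), sub_mul, div_mul_cancel₀ _ (by positivity)]
        ring
      rw [h3]
      field_simp
      ring
    rw [e, ENNReal.ofReal_pow (by positivity)] at h
    exact (ENNReal.pow_right_strictMono two_ne_zero).le_iff_le.1 h
  refine ENNReal.le_of_forall_pos_le_add fun δ hδ _ => ?_
  refine (key δ hδ).trans (le_of_eq ?_)
  rw [ENNReal.ofReal_add (by positivity) (by positivity), ENNReal.ofReal_coe_nnreal]

/-! ### The weighted Laplacian and its inverse -/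

theorem pi_pos (x : X) : 0 < M.pi x := by
  obtain ⟨a, ha⟩ : ∃ a, 0 < M.pi a := by
    by_contra! h
    have := Finset.sum_nonpos fun a (_ : a ∈ Finset.univ) => h a
    rw [M.pi_sum] at this
    linarith
  -- Reversibility propagates positive mass along each transition of positive rate.
  induction M.irreducible a x with
  | refl => exact ha
  | @tail b c _ hbc ih =>
    have h : 0 < M.Q c b * M.pi c := M.detailed_balance b c ▸ mul_pos hbc ih
    exact (M.pi_nonneg c).lt_of_ne fun h0 => by simp [← h0] at h

/-- A Poincaré inequality: irreducibility lets the unweighted Dirichlet form control all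
differences of values. -/
theorem exists_sq_sub_le_dirichlet (M : MarkovTriple X) :
    ∃ K : ℝ, 0 < K ∧ ∀ (ψ : X → ℝ) (x y : X),
      (ψ x - ψ y) ^ 2 ≤ K * ∑ x, ∑ y, (ψ x - ψ y) ^ 2 * M.Q x y * M.pi x := by
  have hterm : ∀ (ψ : X → ℝ) (x y : X), 0 ≤ (ψ x - ψ y) ^ 2 * M.Q x y * M.pi x :=
    fun ψ x y => mul_nonneg (mul_nonneg (sq_nonneg _) (M.Q_nonneg _ _)) (M.pi_nonneg _)
  have hD : ∀ ψ : X → ℝ, 0 ≤ ∑ x, ∑ y, (ψ x - ψ y) ^ 2 * M.Q x y * M.pi x := fun ψ =>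
    Finset.sum_nonneg fun x _ => Finset.sum_nonneg fun y _ => hterm ψ x y
  have hpair : ∀ x y : X, ∃ K : ℝ, 0 ≤ K ∧ ∀ ψ : X → ℝ,
      (ψ x - ψ y) ^ 2 ≤ K * ∑ x, ∑ y, (ψ x - ψ y) ^ 2 * M.Q x y * M.pi x := by
    intro x y
    induction M.irreducible x y with
    | refl => exact ⟨0, le_rfl, fun ψ => by simp⟩
    | @tail b c _ hbc ih =>
      obtain ⟨K, hK, H⟩ := ih
      have hq : 0 < M.Q b c * M.pi b := mul_pos hbc (pi_pos b)
      refine ⟨2 * K + 2 / (M.Q b c * M.pi b), by positivity, fun ψ => ?_⟩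
      have h1 : (ψ b - ψ c) ^ 2 * M.Q b c * M.pi b ≤
          ∑ x, ∑ y, (ψ x - ψ y) ^ 2 * M.Q x y * M.pi x :=
        (Finset.single_le_sum (fun y _ => hterm ψ b y) (Finset.mem_univ c)).trans
          (Finset.single_le_sum (f := fun x => ∑ y, (ψ x - ψ y) ^ 2 * M.Q x y * M.pi x)
            (fun x _ => Finset.sum_nonneg fun y _ => hterm ψ x y) (Finset.mem_univ b))
      have h2 : (ψ b - ψ c) ^ 2 ≤
          (∑ x, ∑ y, (ψ x - ψ y) ^ 2 * M.Q x y * M.pi x) / (M.Q b c * M.pi b) := by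
        rwa [le_div_iff₀ hq, ← mul_assoc]
      calc (ψ x - ψ c) ^ 2 ≤ 2 * (ψ x - ψ b) ^ 2 + 2 * (ψ b - ψ c) ^ 2 := by
            linarith [sq_nonneg ((ψ x - ψ b) - (ψ b - ψ c)),
              (by ring : (ψ x - ψ c) ^ 2 + ((ψ x - ψ b) - (ψ b - ψ c)) ^ 2 =
                2 * (ψ x - ψ b) ^ 2 + 2 * (ψ b - ψ c) ^ 2)]
        _ ≤ 2 * (K * ∑ x, ∑ y, (ψ x - ψ y) ^ 2 * M.Q x y * M.pi x) +
            2 * ((∑ x, ∑ y, (ψ x - ψ y) ^ 2 * M.Q x y * M.pi x) / (M.Q b c * M.pi b)) := by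
            gcongr
            exact H ψ
        _ = _ := by ring
  choose K hK H using hpair
  have hS : 0 ≤ ∑ x, ∑ y, K x y :=
    Finset.sum_nonneg fun x _ => Finset.sum_nonneg fun y _ => hK x y
  refine ⟨1 + ∑ x, ∑ y, K x y, by positivity, fun ψ x y => (H x y ψ).trans ?_⟩
  refine mul_le_mul_of_nonneg_right ?_ (hD ψ)
  have h1 : K x y ≤ ∑ x, ∑ y, K x y :=
    (Finset.single_le_sum (fun y _ => hK x y) (Finset.mem_univ y)).trans
      (Finset.single_le_sum (f := fun x => ∑ y, K x y)
        (fun x _ => Finset.sum_nonneg fun y _ => hK x y) (Finset.mem_univ x))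
  linarith

/-- The time derivative `-∑_y (ψ(y) - ψ(x)) θ(ρ(x), ρ(y)) Q(x,y)` that the continuity equation
prescribes: the `ρ`-weighted Laplacian of `ψ`, with the positive sign. -/
noncomputable def laplacian (M : MarkovTriple X) (ρ ψ : X → ℝ) (x : X) : ℝ :=
  -∑ y, (ψ y - ψ x) * logMean (ρ x) (ρ y) * M.Q x y

theorem sum_pi_mul_laplacian (ρ ψ φ : X → ℝ) :
    ∑ x, M.pi x * φ x * M.laplacian ρ ψ x =
      (1 / 2) * ∑ x, ∑ y,
        (ψ x - ψ y) * (φ x - φ y) * logMean (ρ x) (ρ y) * M.Q x y * M.pi x := by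
  have h1 : ∑ x, M.pi x * φ x * M.laplacian ρ ψ x =
      ∑ x, ∑ y, (ψ x - ψ y) * φ x * logMean (ρ x) (ρ y) * M.Q x y * M.pi x := by
    refine Finset.sum_congr rfl fun x _ => ?_
    rw [laplacian, ← Finset.sum_neg_distrib, Finset.mul_sum]
    exact Finset.sum_congr rfl fun y _ => by ring
  have h2 : ∑ x, M.pi x * φ x * M.laplacian ρ ψ x =
      ∑ x, ∑ y, (ψ x - ψ y) * (-φ y) * logMean (ρ x) (ρ y) * M.Q x y * M.pi x := by
    rw [h1, Finset.sum_comm]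
    refine Finset.sum_congr rfl fun x _ => Finset.sum_congr rfl fun y _ => ?_
    rw [logMean_comm (ρ y), mul_assoc _ (M.Q y x), M.detailed_balance y x]
    ring
  have h3 : ∑ x, ∑ y, (ψ x - ψ y) * (φ x - φ y) * logMean (ρ x) (ρ y) * M.Q x y * M.pi x =
      (∑ x, ∑ y, (ψ x - ψ y) * φ x * logMean (ρ x) (ρ y) * M.Q x y * M.pi x) +
      ∑ x, ∑ y, (ψ x - ψ y) * (-φ y) * logMean (ρ x) (ρ y) * M.Q x y * M.pi x := by
    simp only [← Finset.sum_add_distrib]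
    exact Finset.sum_congr rfl fun x _ => Finset.sum_congr rfl fun y _ => by ring
  rw [h3, ← h1, ← h2]
  ring

theorem sum_pi_mul_laplacian_self (ρ ψ : X → ℝ) :
    ∑ x, M.pi x * ψ x * M.laplacian ρ ψ x = M.energy ρ ψ := by
  rw [sum_pi_mul_laplacian, energy]
  simp only [sq]

theorem sum_pi_laplacian (ρ ψ : X → ℝ) : ∑ x, M.pi x * M.laplacian ρ ψ x = 0 := by
  simpa using sum_pi_mul_laplacian (M := M) ρ ψ (fun _ => 1)

theorem sq_sub_le_energy {K m : ℝ} (hm : 0 < m) (hK0 : 0 < K)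
    (hK : ∀ (ψ : X → ℝ) (x y : X),
      (ψ x - ψ y) ^ 2 ≤ K * ∑ x, ∑ y, (ψ x - ψ y) ^ 2 * M.Q x y * M.pi x)
    {ρ : X → ℝ} (hρ : ∀ x, m ≤ ρ x) (ψ : X → ℝ) (x y : X) :
    (ψ x - ψ y) ^ 2 ≤ 2 * K / m * M.energy ρ ψ := by
  have h : m * ∑ x, ∑ y, (ψ x - ψ y) ^ 2 * M.Q x y * M.pi x ≤ 2 * M.energy ρ ψ := by
    rw [energy, ← mul_assoc, mul_one_div_cancel two_ne_zero, one_mul, Finset.mul_sum]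
    refine Finset.sum_le_sum fun x _ => ?_
    rw [Finset.mul_sum]
    refine Finset.sum_le_sum fun y _ => ?_
    have h1 := le_logMean hm (hρ x) (hρ y)
    have h2 : 0 ≤ (ψ x - ψ y) ^ 2 * M.Q x y * M.pi x :=
      mul_nonneg (mul_nonneg (sq_nonneg _) (M.Q_nonneg _ _)) (M.pi_nonneg _)
    calc m * ((ψ x - ψ y) ^ 2 * M.Q x y * M.pi x)
        ≤ logMean (ρ x) (ρ y) * ((ψ x - ψ y) ^ 2 * M.Q x y * M.pi x) := by gcongr
      _ = _ := by ring
  refine (hK ψ x y).trans ?_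
  rw [div_mul_eq_mul_div, le_div_iff₀ hm]
  calc K * (∑ x, ∑ y, (ψ x - ψ y) ^ 2 * M.Q x y * M.pi x) * m
      = K * (m * ∑ x, ∑ y, (ψ x - ψ y) ^ 2 * M.Q x y * M.pi x) := by ring
    _ ≤ K * (2 * M.energy ρ ψ) := by gcongr
    _ = _ := by ring

open Classical in
/-- The matrix of `ψ ↦ laplacian ρ ψ + ∑_y π(y) ψ(y)`. The rank-one term removes the constants
from the kernel, so that the matrix is invertible whenever `ρ` is positive. -/
noncomputable def laplacianMatrix (M : MarkovTriple X) (ρ : X → ℝ) : Matrix X X ℝ :=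
  fun x y => (if x = y then ∑ z, logMean (ρ x) (ρ z) * M.Q x z else 0)
    - logMean (ρ x) (ρ y) * M.Q x y + M.pi y

theorem laplacianMatrix_mulVec (ρ ψ : X → ℝ) (x : X) :
    (M.laplacianMatrix ρ).mulVec ψ x = M.laplacian ρ ψ x + ∑ y, M.pi y * ψ y := by
  classical
  simp only [Matrix.mulVec, dotProduct, laplacianMatrix, add_mul, sub_mul,
    Finset.sum_add_distrib, Finset.sum_sub_distrib, ite_mul, zero_mul, Finset.sum_ite_eq,
    Finset.mem_univ, if_true]
  rw [Finset.sum_mul, ← Finset.sum_sub_distrib, laplacian, ← Finset.sum_neg_distrib]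
  congr 1
  exact Finset.sum_congr rfl fun y _ => by ring

open Classical in
/-- The canonical potential for the velocity `σ` at the density `ρ`. -/
noncomputable def potential (M : MarkovTriple X) (ρ σ : X → ℝ) : X → ℝ :=
  (M.laplacianMatrix ρ)⁻¹.mulVec σ

theorem laplacian_potential {m : ℝ} (hm : 0 < m) {ρ σ : X → ℝ} (hρ : ∀ x, m ≤ ρ x)
    (hσ : ∑ x, M.pi x * σ x = 0) (x : X) : M.laplacian ρ (M.potential ρ σ) x = σ x := by
  classical
  -- Integrating `A ψ` against `π` recovers the mean of `ψ`.
  have hmean : ∀ ψ : X → ℝ, ∑ x, M.pi x * (M.laplacianMatrix ρ).mulVec ψ x =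
      ∑ y, M.pi y * ψ y := by
    intro ψ
    simp only [laplacianMatrix_mulVec, mul_add, Finset.sum_add_distrib, sum_pi_laplacian,
      ← Finset.sum_mul, M.pi_sum, zero_add, one_mul]
  have hinj : Function.Injective (M.laplacianMatrix ρ).mulVec := by
    rw [← Matrix.coe_mulVecLin, injective_iff_map_eq_zero]
    intro ψ hψ
    rw [Matrix.mulVecLin_apply] at hψ
    have hm0 : ∑ y, M.pi y * ψ y = 0 := by
      rw [← hmean ψ, hψ]; simp
    have hL : ∀ x, M.laplacian ρ ψ x = 0 := by
      intro x
      have := congrFun hψ x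
      rwa [laplacianMatrix_mulVec, hm0, add_zero] at this
    have hE : M.energy ρ ψ = 0 := by
      rw [← sum_pi_mul_laplacian_self]
      simp [hL]
    obtain ⟨K, hK0, hK⟩ := M.exists_sq_sub_le_dirichlet
    funext x
    have hconst : ∀ y, ψ y = ψ x := by
      intro y
      have h := sq_sub_le_energy hm hK0 hK hρ ψ y x
      rw [hE, mul_zero] at h
      exact sub_eq_zero.1 (pow_eq_zero_iff two_ne_zero |>.1 (le_antisymm h (sq_nonneg _)))
    simpa [hconst, ← Finset.sum_mul, M.pi_sum] using hm0
  have hunit : IsUnit (M.laplacianMatrix ρ) := Matrix.mulVec_injective_iff_isUnit.1 hinj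
  have hsol : (M.laplacianMatrix ρ).mulVec (M.potential ρ σ) = σ := by
    rw [potential, Matrix.mulVec_mulVec,
      Matrix.mul_nonsing_inv _ ((Matrix.isUnit_iff_isUnit_det _).1 hunit), Matrix.one_mulVec]
  have h0 := hmean (M.potential ρ σ)
  rw [hsol, hσ] at h0
  have := laplacianMatrix_mulVec (M := M) ρ (M.potential ρ σ) x
  rw [hsol, ← h0, add_zero] at this
  exact this.symm

theorem measurable_potential {ρ σ : ℝ → X → ℝ} (hρ : Measurable ρ) (hσ : Measurable σ) :
    Measurable fun t => M.potential (ρ t) (σ t) := by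
  classical
  have hA : Measurable fun t (x y : X) => M.laplacianMatrix (ρ t) x y := by
    refine measurable_pi_lambda _ fun x => measurable_pi_lambda _ fun y => ?_
    have hl : ∀ x y, Measurable fun t => logMean (ρ t x) (ρ t y) := fun x y =>
      measurable_logMean.comp
        (((measurable_pi_apply x).comp hρ).prodMk ((measurable_pi_apply y).comp hρ))
    unfold laplacianMatrix
    refine Measurable.add_const (Measurable.sub ?_ ((hl x y).mul_const _)) _
    split_ifs
    · exact Finset.measurable_sum _ fun z _ => (hl x z).mul_const _
    · exact measurable_const
  have hof : Continuous fun B : X → X → ℝ => Matrix.of B :=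
    continuous_matrix fun x y => (continuous_apply y).comp (continuous_apply x)
  have hdet : Measurable fun B : X → X → ℝ => Matrix.det (Matrix.of B) :=
    hof.matrix_det.measurable
  have hadj : ∀ x y, Measurable fun B : X → X → ℝ => Matrix.adjugate (Matrix.of B) x y :=
    fun x y => (hof.matrix_adjugate.matrix_elem x y).measurable
  refine measurable_pi_lambda _ fun x => ?_
  simp only [potential, Matrix.mulVec, dotProduct, Matrix.inv_def, Matrix.smul_apply,
    Ring.inverse_eq_inv', smul_eq_mul]
  refine Finset.measurable_sum _ fun y _ => ?_
  exact (((hdet.comp hA).inv).mul ((hadj x y).comp hA)).mul ((measurable_pi_apply y).comp hσ)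

/-- Duality between the Dirichlet form and its inverse: `energy = ∑ π (ψ - ψ(x₀)) σ` is absorbed
by the Poincaré inequality and Young's inequality. -/
theorem energy_le_of_laplacian_eq {K m : ℝ} (hm : 0 < m) (hK0 : 0 < K)
    (hK : ∀ (ψ : X → ℝ) (x y : X),
      (ψ x - ψ y) ^ 2 ≤ K * ∑ x, ∑ y, (ψ x - ψ y) ^ 2 * M.Q x y * M.pi x)
    {ρ ψ σ : X → ℝ} (hρ : ∀ x, m ≤ ρ x) (h : ∀ x, M.laplacian ρ ψ x = σ x) :
    M.energy ρ ψ ≤ 2 * K * ‖σ‖ ^ 2 / m := by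
  rcases isEmpty_or_nonempty X with hX | ⟨⟨x₀⟩⟩
  · simp only [energy, Finset.univ_eq_empty, Finset.sum_empty, mul_zero]
    positivity
  have hmean : ∑ x, M.pi x * σ x = 0 := by
    simpa only [h] using sum_pi_laplacian (M := M) ρ ψ
  set E := M.energy ρ ψ with hE
  have h1 : E = ∑ x, M.pi x * ((ψ x - ψ x₀) * σ x) := by
    have e : ∑ x, M.pi x * ((ψ x - ψ x₀) * σ x) =
        ∑ x, M.pi x * ψ x * σ x - ψ x₀ * ∑ x, M.pi x * σ x := by
      rw [Finset.mul_sum, ← Finset.sum_sub_distrib]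
      exact Finset.sum_congr rfl fun x _ => by ring
    rw [e, hmean, mul_zero, sub_zero, hE, ← sum_pi_mul_laplacian_self]
    simp only [h]
  have h2 : ∀ x, (ψ x - ψ x₀) * σ x ≤ E / 2 + K / m * ‖σ‖ ^ 2 := by
    intro x
    have ha := sq_sub_le_energy hm hK0 hK hρ ψ x x₀
    have hb : σ x ^ 2 ≤ ‖σ‖ ^ 2 := by
      rw [← sq_abs (σ x)]
      gcongr
      exact norm_le_pi_norm σ x
    have hc : 0 < m / (4 * K) := by positivity
    calc (ψ x - ψ x₀) * σ x
        ≤ m / (4 * K) * (ψ x - ψ x₀) ^ 2 + K / m * σ x ^ 2 := by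
          have hsq := sq_nonneg (m / (2 * K) * (ψ x - ψ x₀) - σ x)
          have e : m / (4 * K) * (ψ x - ψ x₀) ^ 2 + K / m * σ x ^ 2 - (ψ x - ψ x₀) * σ x =
              K / m * (m / (2 * K) * (ψ x - ψ x₀) - σ x) ^ 2 := by
            field_simp
            ring
          have : 0 ≤ K / m * (m / (2 * K) * (ψ x - ψ x₀) - σ x) ^ 2 := by positivity
          linarith
      _ ≤ m / (4 * K) * (2 * K / m * E) + K / m * ‖σ‖ ^ 2 := by gcongr
      _ = _ := by field_simp; ring
  have h3 : E ≤ E / 2 + K / m * ‖σ‖ ^ 2 := by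
    calc E = ∑ x, M.pi x * ((ψ x - ψ x₀) * σ x) := h1
      _ ≤ ∑ x, M.pi x * (E / 2 + K / m * ‖σ‖ ^ 2) :=
          Finset.sum_le_sum fun x _ => mul_le_mul_of_nonneg_left (h2 x) (M.pi_nonneg x)
      _ = _ := by rw [← Finset.sum_mul, M.pi_sum, one_mul]
  have h4 : 2 * K * ‖σ‖ ^ 2 / m = 2 * (K / m * ‖σ‖ ^ 2) := by ring
  linarith

/-! ### The transport distance is controlled by the Euclidean topology -/

/-- The curve is `ρ_t = ρ₀ + t² (ρ₁ - ρ₀)`. Its velocity is of order `t` and its density is at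
least `t² m`, so that the energy `velocity² / density` stays bounded as `t → 0`, even where `ρ₀`
vanishes. -/
theorem W_sq_le_of_pos {K m : ℝ} (hm : 0 < m) (hK0 : 0 < K)
    (hK : ∀ (ψ : X → ℝ) (x y : X),
      (ψ x - ψ y) ^ 2 ≤ K * ∑ x, ∑ y, (ψ x - ψ y) ^ 2 * M.Q x y * M.pi x)
    {ρ₀ ρ₁ : X → ℝ} (h₀ : ρ₀ ∈ M.densities) (h₁ : ρ₁ ∈ M.densities) (hpos : ∀ x, m ≤ ρ₁ x) :
    M.W ρ₀ ρ₁ ^ 2 ≤ ENNReal.ofReal (8 * K * ‖ρ₁ - ρ₀‖ ^ 2 / m) := by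
  set ρ : ℝ → X → ℝ := fun t => ρ₀ + t ^ 2 • (ρ₁ - ρ₀) with hρ
  set σ : ℝ → X → ℝ := fun t => (2 * t) • (ρ₁ - ρ₀) with hσ
  set ψ : ℝ → X → ℝ := fun t => M.potential (ρ t) (σ t) with hψ
  have happly : ∀ t x, ρ t x = (1 - t ^ 2) * ρ₀ x + t ^ 2 * ρ₁ x := by
    intro t x
    simp only [hρ, Pi.add_apply, Pi.smul_apply, Pi.sub_apply, smul_eq_mul]
    ring
  have hsum : ∀ t, ∑ x, M.pi x * σ t x = 0 := by
    intro t
    have e : ∀ x, M.pi x * σ t x = 2 * t * (M.pi x * ρ₁ x - M.pi x * ρ₀ x) := by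
      intro x
      simp only [hσ, Pi.smul_apply, Pi.sub_apply, smul_eq_mul]
      ring
    simp only [e, ← Finset.mul_sum, Finset.sum_sub_distrib, h₀.2, h₁.2, sub_self, mul_zero]
  have hlow : ∀ t ∈ Ioc (0 : ℝ) 1, ∀ x, t ^ 2 * m ≤ ρ t x := by
    intro t ht x
    rw [happly]
    have h1 : 0 ≤ 1 - t ^ 2 := by nlinarith [ht.1, ht.2]
    have h2 := mul_nonneg h1 (h₀.1 x)
    have h3 := mul_le_mul_of_nonneg_left (hpos x) (sq_nonneg t)
    linarith
  have hlap : ∀ t ∈ Ioc (0 : ℝ) 1, ∀ x, M.laplacian (ρ t) (ψ t) x = σ t x := fun t ht x =>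
    laplacian_potential (mul_pos (pow_pos ht.1 2) hm) (hlow t ht) (hsum t) x
  have hsol : M.SolvesContinuityEq ρ₀ ρ₁ ρ ψ := by
    refine ⟨fun t ht => ⟨fun x => ?_, ?_⟩, fun x => ?_, ?_, ?_, ?_, ?_⟩
    · rw [happly]
      have h1 : 0 ≤ 1 - t ^ 2 := by nlinarith [ht.1, ht.2]
      exact add_nonneg (mul_nonneg h1 (h₀.1 x)) (mul_nonneg (sq_nonneg t) (h₁.1 x))
    · have e : ∀ x, M.pi x * ρ t x =
          (1 - t ^ 2) * (M.pi x * ρ₀ x) + t ^ 2 * (M.pi x * ρ₁ x) := fun x => by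
        rw [happly]; ring
      simp only [e, Finset.sum_add_distrib, ← Finset.mul_sum, h₀.2, h₁.2]
      ring
    · refine ContDiffOn.absolutelyContinuousOnInterval (ContDiff.contDiffOn ?_)
      simp only [happly]
      fun_prop
    · refine measurable_potential ?_ ?_
      · exact (by fun_prop : Continuous ρ).measurable
      · exact (by fun_prop : Continuous σ).measurable
    · rw [ae_restrict_iff' measurableSet_Icc]
      filter_upwards [Measure.ae_ne volume (0 : ℝ)] with t ht0 ht x
      refine HasDerivAt.congr_deriv (f' := σ t x) ?_
        (hlap t ⟨lt_of_le_of_ne ht.1 ht0.symm, ht.2⟩ x).symm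
      have hd : HasDerivAt (fun s : ℝ => ρ₀ x + s ^ 2 * (ρ₁ x - ρ₀ x))
          (2 * t * (ρ₁ x - ρ₀ x)) t := by
        simpa using ((hasDerivAt_pow 2 t).mul_const (ρ₁ x - ρ₀ x)).const_add (ρ₀ x)
      exact hd
    · simp [hρ]
    · simp [hρ]
  refine (W_sq_le_action hsol).trans ?_
  have hbound : ∀ t ∈ Ioc (0 : ℝ) 1,
      M.energy (ρ t) (ψ t) ≤ 8 * K * ‖ρ₁ - ρ₀‖ ^ 2 / m := by
    intro t ht
    have ht0 := ht.1
    refine (energy_le_of_laplacian_eq (mul_pos (pow_pos ht.1 2) hm) hK0 hK (hlow t ht)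
      (hlap t ht)).trans (le_of_eq ?_)
    rw [hσ, norm_smul, Real.norm_of_nonneg (by positivity)]
    field_simp
    ring
  calc M.action ρ ψ = ∫⁻ t in Ioc (0 : ℝ) 1, ENNReal.ofReal (M.energy (ρ t) (ψ t)) :=
        setLIntegral_congr Ioc_ae_eq_Icc.symm
    _ ≤ ∫⁻ _ in Ioc (0 : ℝ) 1, ENNReal.ofReal (8 * K * ‖ρ₁ - ρ₀‖ ^ 2 / m) :=
        setLIntegral_mono measurable_const fun t ht => ENNReal.ofReal_le_ofReal (hbound t ht)
    _ = _ := by simp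

theorem one_mem_densities : (fun _ => 1 : X → ℝ) ∈ M.densities :=
  ⟨fun _ => zero_le_one, by simp [M.pi_sum]⟩

theorem isCompact_densities (M : MarkovTriple X) : IsCompact M.densities := by
  refine IsCompact.of_isClosed_subset
    (isCompact_univ_pi fun x => isCompact_Icc (a := (0 : ℝ)) (b := 1 / M.pi x)) ?_ ?_
  · have h1 : IsClosed {ρ : X → ℝ | ∀ x, 0 ≤ ρ x} := by
      simp only [ofPred_forall]
      exact isClosed_iInter fun x => isClosed_le continuous_const (continuous_apply x)
    have h2 : IsClosed {ρ : X → ℝ | ∑ x, M.pi x * ρ x = 1} :=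
      isClosed_eq (by fun_prop) continuous_const
    exact h1.inter h2
  · intro ρ hρ x _
    refine ⟨hρ.1 x, ?_⟩
    rw [le_div_iff₀ (pi_pos x), mul_comm, ← hρ.2]
    exact Finset.single_le_sum (f := fun x => M.pi x * ρ x)
      (fun y _ => mul_nonneg (M.pi_nonneg y) (hρ.1 y)) (Finset.mem_univ x)

theorem _root_.ENNReal.le_ofReal_of_sq_le {a : ℝ≥0∞} {c : ℝ} (hc : 0 ≤ c)
    (h : a ^ 2 ≤ ENNReal.ofReal (c ^ 2)) : a ≤ ENNReal.ofReal c := by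
  rw [ENNReal.ofReal_pow hc] at h
  exact (ENNReal.pow_right_strictMono two_ne_zero).le_iff_le.1 h

/-- Hölder continuity of the transport distance: both densities are joined to the mixture
`(1 - ε) σ + ε`, which is bounded below by `ε` and within distance of order `ε` of both. -/
theorem exists_W_le_sqrt (M : MarkovTriple X) : ∃ C : ℝ, 0 ≤ C ∧
    ∀ σ ∈ M.densities, ∀ τ ∈ M.densities, ‖σ - τ‖ ≤ 1 →
      M.W σ τ ≤ ENNReal.ofReal (C * √‖σ - τ‖) := by
  obtain ⟨K, hK0, hK⟩ := M.exists_sq_sub_le_dirichlet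
  obtain ⟨B, hB⟩ := M.isCompact_densities.exists_bound_of_continuousOn
    (f := fun ρ => (fun _ => 1 : X → ℝ) - ρ) (by fun_prop)
  have hB0 : 0 ≤ B := (norm_nonneg _).trans (hB _ one_mem_densities)
  refine ⟨√(8 * K) * (1 + B) + √(8 * K) * (1 + B), by positivity, fun σ hσ τ hτ hle => ?_⟩
  rcases (norm_nonneg (σ - τ)).eq_or_lt with h0 | hε
  · obtain rfl : σ = τ := sub_eq_zero.1 (norm_eq_zero.1 h0.symm)
    simp [W_self hσ]
  set ε := ‖σ - τ‖ with hεdef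
  set μ : X → ℝ := σ + ε • ((fun _ => 1 : X → ℝ) - σ) with hμ
  have hμapply : ∀ x, μ x = (1 - ε) * σ x + ε := by
    intro x
    simp only [hμ, Pi.add_apply, Pi.smul_apply, Pi.sub_apply, smul_eq_mul]
    ring
  have hlow : ∀ x, ε ≤ μ x := fun x => by
    rw [hμapply]
    linarith [mul_nonneg (sub_nonneg.2 hle) (hσ.1 x)]
  have hμmem : μ ∈ M.densities := by
    refine ⟨fun x => hε.le.trans (hlow x), ?_⟩
    have e : ∀ x, M.pi x * μ x = (1 - ε) * (M.pi x * σ x) + ε * M.pi x := fun x => by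
      rw [hμapply]; ring
    simp only [e, Finset.sum_add_distrib, ← Finset.mul_sum, hσ.2, M.pi_sum]
    ring
  have hμσ : ‖μ - σ‖ ≤ ε * B := by
    rw [hμ, add_sub_cancel_left, norm_smul, Real.norm_of_nonneg hε.le]
    gcongr
    exact hB σ hσ
  have hbound : ∀ ν ∈ M.densities, ‖μ - ν‖ ≤ ε * (1 + B) →
      M.W ν μ ≤ ENNReal.ofReal (√(8 * K) * (1 + B) * √ε) := by
    intro ν hν hνle
    refine ENNReal.le_ofReal_of_sq_le (by positivity)
      ((W_sq_le_of_pos hε hK0 hK hν hμmem hlow).trans (ENNReal.ofReal_le_ofReal ?_))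
    calc 8 * K * ‖μ - ν‖ ^ 2 / ε ≤ 8 * K * (ε * (1 + B)) ^ 2 / ε := by gcongr
      _ = (√(8 * K) * (1 + B) * √ε) ^ 2 := by
        rw [mul_pow _ (√ε), mul_pow √(8 * K), Real.sq_sqrt (by positivity), Real.sq_sqrt hε.le]
        field_simp
  have h1 := hbound σ hσ (hμσ.trans (by gcongr; linarith))
  have h2 := hbound τ hτ (by
    calc ‖μ - τ‖ = ‖(μ - σ) + (σ - τ)‖ := by rw [sub_add_sub_cancel]
      _ ≤ ε * B + ε := (norm_add_le _ _).trans (by gcongr)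
      _ = ε * (1 + B) := by ring)
  rw [W_comm] at h2
  refine (W_triangle σ μ τ).trans ((add_le_add h1 h2).trans (le_of_eq ?_))
  rw [← ENNReal.ofReal_add (by positivity) (by positivity), add_mul]

theorem W_ne_top {σ τ : X → ℝ} (hσ : σ ∈ M.densities) (hτ : τ ∈ M.densities) :
    M.W σ τ ≠ ⊤ := by
  obtain ⟨K, hK0, hK⟩ := M.exists_sq_sub_le_dirichlet
  have H : ∀ ρ ∈ M.densities, M.W ρ (fun _ => 1) ≠ ⊤ := by
    intro ρ hρ htop
    have h := W_sq_le_of_pos zero_lt_one hK0 hK hρ one_mem_densities fun _ => le_rfl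
    simp [htop] at h
  refine ne_top_of_le_ne_top ?_ (W_triangle σ (fun _ => 1) τ)
  rw [W_comm _ τ]
  exact ENNReal.add_ne_top.2 ⟨H σ hσ, H τ hτ⟩

theorem toReal_W_triangle {ρ σ τ : X → ℝ} (hρ : ρ ∈ M.densities) (hσ : σ ∈ M.densities)
    (hτ : τ ∈ M.densities) :
    (M.W ρ τ).toReal ≤ (M.W ρ σ).toReal + (M.W σ τ).toReal := by
  rw [← ENNReal.toReal_add (W_ne_top hρ hσ) (W_ne_top hσ hτ)]
  exact ENNReal.toReal_mono (ENNReal.add_ne_top.2 ⟨W_ne_top hρ hσ, W_ne_top hσ hτ⟩)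
    (W_triangle ρ σ τ)

open Filter Topology in
theorem tendsto_toReal_W {ι : Type*} {l : Filter ι} {σ τ : ι → X → ℝ} {σ' τ' : X → ℝ}
    (hσ : ∀ i, σ i ∈ M.densities) (hτ : ∀ i, τ i ∈ M.densities) (hσ' : σ' ∈ M.densities)
    (hτ' : τ' ∈ M.densities) (h₁ : Tendsto σ l (𝓝 σ')) (h₂ : Tendsto τ l (𝓝 τ')) :
    Tendsto (fun i => (M.W (σ i) (τ i)).toReal) l (𝓝 (M.W σ' τ').toReal) := by
  obtain ⟨C, hC, H⟩ := M.exists_W_le_sqrt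
  have key : ∀ {ν : ι → X → ℝ} {ν' : X → ℝ}, (∀ i, ν i ∈ M.densities) → ν' ∈ M.densities →
      Tendsto ν l (𝓝 ν') → Tendsto (fun i => (M.W (ν i) ν').toReal) l (𝓝 0) := by
    intro ν ν' hν hν' hlim
    have hn : Tendsto (fun i => ‖ν i - ν'‖) l (𝓝 0) := tendsto_iff_norm_sub_tendsto_zero.1 hlim
    have hs : Tendsto (fun i => C * √‖ν i - ν'‖) l (𝓝 0) := by
      simpa using ((Real.continuous_sqrt.tendsto 0).comp hn).const_mul C
    refine squeeze_zero' (Eventually.of_forall fun i => ENNReal.toReal_nonneg) ?_ hs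
    filter_upwards [hn.eventually_le_const zero_lt_one] with i hi
    exact ENNReal.toReal_le_of_le_ofReal (by positivity) (H _ (hν i) _ hν' hi)
  rw [tendsto_iff_norm_sub_tendsto_zero]
  have hsum := (key hσ hσ' h₁).add (key hτ hτ' h₂)
  rw [add_zero] at hsum
  refine squeeze_zero (fun i => norm_nonneg _) (fun i => ?_) hsum
  rw [Real.norm_eq_abs, abs_le]
  have a1 := toReal_W_triangle (hσ i) hσ' (hτ i)
  have a2 := toReal_W_triangle hσ' hτ' (hτ i)
  have a3 := toReal_W_triangle hσ' (hσ i) hτ'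
  have a4 := toReal_W_triangle (hσ i) (hτ i) hτ'
  rw [W_comm τ' (τ i)] at a2
  rw [W_comm σ' (σ i)] at a3
  constructor <;> linarith

/-! ### Constant speed geodesics -/

theorem add_sq_le_add_mul_add {a c p q A B : ℝ} (hp : 0 ≤ p) (hq : 0 ≤ q) (hA : 0 ≤ A)
    (hB : 0 ≤ B) (ha : a ^ 2 ≤ p * A) (hc : c ^ 2 ≤ q * B) :
    (a + c) ^ 2 ≤ (p + q) * (A + B) := by
  have h1 : (2 * (a * c)) ^ 2 ≤ (p * B + q * A) ^ 2 := by
    have h2 : a ^ 2 * c ^ 2 ≤ p * A * (q * B) := by gcongr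
    linarith [sq_nonneg (p * B - q * A), (by ring : (2 * (a * c)) ^ 2 = 4 * (a ^ 2 * c ^ 2)),
      (by ring : (p * B + q * A) ^ 2 - (p * B - q * A) ^ 2 = 4 * (p * A * (q * B)))]
  have h3 := (abs_le_of_sq_le_sq' h1 (by positivity)).2
  linarith

/-- The equality case of the convexity of the square: the bounds give `(b - h w)² ≤ 0`. -/
theorem eq_mul_of_chord_bounds {h w u b : ℝ} (h0 : 0 ≤ h) (h1 : h ≤ 1) (hw : 0 ≤ w)
    (hb : 0 ≤ b) (hin : b ^ 2 ≤ h * w ^ 2)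
    (hout : h * u ^ 2 + (1 - h) * b ^ 2 ≤ h * (1 - h) * w ^ 2) (htri : w ≤ u + b) :
    b = h * w := by
  have hbw : b ≤ w := by
    refine (sq_le_sq₀ hb hw).1 (hin.trans ?_)
    exact mul_le_of_le_one_left (sq_nonneg w) h1
  have hu : (w - b) ^ 2 ≤ u ^ 2 := by
    have : 0 ≤ w - b := sub_nonneg.2 hbw
    gcongr
    linarith
  have h2 := mul_le_mul_of_nonneg_left hu h0
  have h3 : (b - h * w) ^ 2 ≤ 0 := by linarith
  exact sub_eq_zero.1 (pow_eq_zero_iff two_ne_zero |>.1 (le_antisymm h3 (sq_nonneg _)))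

/-- Splitting the action of a flow at the times `s ≤ t`. Each piece, rescaled to unit time, bounds
the distance of its endpoints; the two outer pieces are combined by the
Cauchy–Schwarz inequality. -/
theorem FlowOn.chord_bounds {A s t : ℝ} {ρ ψ : ℝ → X → ℝ} (h : M.FlowOn 0 1 ρ ψ)
    (hA0 : 0 ≤ A) (hA : M.actionOn 0 1 ρ ψ ≤ ENNReal.ofReal A) (hs : 0 ≤ s) (hst : s ≤ t)
    (ht : t ≤ 1) :
    (M.W (ρ s) (ρ t)).toReal ^ 2 ≤ (t - s) * A ∧
    (t - s) * ((M.W (ρ 0) (ρ s)).toReal + (M.W (ρ t) (ρ 1)).toReal) ^ 2 +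
      (1 - (t - s)) * (M.W (ρ s) (ρ t)).toReal ^ 2 ≤ (t - s) * (1 - (t - s)) * A := by
  have hsplit : M.actionOn 0 s ρ ψ + M.actionOn s t ρ ψ + M.actionOn t 1 ρ ψ ≤
      ENNReal.ofReal A := by
    rw [FlowOn.actionOn_add hs hst, FlowOn.actionOn_add (hs.trans hst) ht]
    exact hA
  have hfin : M.actionOn 0 s ρ ψ + M.actionOn s t ρ ψ + M.actionOn t 1 ρ ψ ≠ ⊤ :=
    ne_top_of_le_ne_top ENNReal.ofReal_ne_top hsplit
  have hfin3 := (ENNReal.add_ne_top.1 hfin).2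
  have hfin1 := (ENNReal.add_ne_top.1 (ENNReal.add_ne_top.1 hfin).1).1
  have hfin2 := (ENNReal.add_ne_top.1 (ENNReal.add_ne_top.1 hfin).1).2
  have hsum := ENNReal.toReal_le_of_le_ofReal hA0 hsplit
  rw [ENNReal.toReal_add (ENNReal.add_ne_top.1 hfin).1 hfin3,
    ENNReal.toReal_add hfin1 hfin2] at hsum
  have hpiece : ∀ p q : ℝ, 0 ≤ p → p ≤ q → q ≤ 1 → M.actionOn p q ρ ψ ≠ ⊤ →
      (M.W (ρ p) (ρ q)).toReal ^ 2 ≤ (q - p) * (M.actionOn p q ρ ψ).toReal := by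
    intro p q hp hpq hq hf
    have hsub : uIcc p q ⊆ uIcc 0 1 := by
      rw [uIcc_of_le hpq, uIcc_of_le zero_le_one]
      exact Icc_subset_Icc hp hq
    have := ENNReal.toReal_mono (ENNReal.mul_ne_top ENNReal.ofReal_ne_top hf)
      ((h.mono hsub).W_sq_le hpq)
    rwa [ENNReal.toReal_pow, ENNReal.toReal_mul,
      ENNReal.toReal_ofReal (sub_nonneg.2 hpq)] at this
  have h1 := hpiece 0 s le_rfl hs (hst.trans ht) hfin1
  have h2 := hpiece s t hs hst ht hfin2
  have h3 := hpiece t 1 (hs.trans hst) ht le_rfl hfin3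
  have hA₁ : 0 ≤ (M.actionOn 0 s ρ ψ).toReal := ENNReal.toReal_nonneg
  have hA₂ : 0 ≤ (M.actionOn s t ρ ψ).toReal := ENNReal.toReal_nonneg
  have hA₃ : 0 ≤ (M.actionOn t 1 ρ ψ).toReal := ENNReal.toReal_nonneg
  rw [sub_zero] at h1
  have h0 : 0 ≤ t - s := sub_nonneg.2 hst
  have h0' : 0 ≤ 1 - (t - s) := by linarith
  have hout := add_sq_le_add_mul_add hs (sub_nonneg.2 ht) hA₁ hA₃ h1 h3
  refine ⟨h2.trans (by gcongr; linarith), ?_⟩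
  have e1 := mul_le_mul_of_nonneg_left hout h0
  have e2 := mul_le_mul_of_nonneg_left h2 h0'
  have e3 := mul_le_mul_of_nonneg_left hsum (mul_nonneg h0 h0')
  linarith

open Filter Topology in
/-- Geodesics arise as pointwise limits, along an ultrafilter, of flows whose action tends to the
infimum; continuity of the distance turns the chord bounds of the flows into equalities. -/
theorem exists_isConstantSpeedGeodesic {σ τ : X → ℝ} (hσ : σ ∈ M.densities)
    (hτ : τ ∈ M.densities) :
    ∃ γ : ℝ → X → ℝ, M.IsConstantSpeedGeodesic γ ∧ γ 0 = σ ∧ γ 1 = τ := by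
  have hu : uIcc (0 : ℝ) 1 = Icc 0 1 := uIcc_of_le zero_le_one
  set w := (M.W σ τ).toReal with hw
  have hw0 : 0 ≤ w := ENNReal.toReal_nonneg
  have hflow : ∀ n : ℕ, ∃ ρ ψ, M.FlowOn 0 1 ρ ψ ∧ ρ 0 = σ ∧ ρ 1 = τ ∧
      M.actionOn 0 1 ρ ψ ≤ ENNReal.ofReal (w ^ 2 + 1 / ((n : ℝ) + 1)) := by
    intro n
    have hn : 0 < 1 / ((n : ℝ) + 1) := Nat.one_div_pos_of_nat
    have hlt : M.W σ τ ^ 2 < ENNReal.ofReal (w ^ 2 + 1 / ((n : ℝ) + 1)) := by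
      rw [← ENNReal.ofReal_toReal (W_ne_top hσ hτ), ← ENNReal.ofReal_pow hw0]
      exact (ENNReal.ofReal_lt_ofReal_iff (by positivity)).2 (by linarith)
    simpa using exists_flowOn zero_lt_one hlt
  choose ρ ψ hf h0 h1 hA using hflow
  have hmem : ∀ t ∈ Icc (0 : ℝ) 1, ∀ n, ρ n t ∈ M.densities := fun t ht n =>
    (hf n).mem_densities t (hu ▸ ht)
  have hlim : ∀ t : ℝ, ∃ g : X → ℝ, t ∈ Icc (0 : ℝ) 1 →
      g ∈ M.densities ∧ Tendsto (fun n => ρ n t) (hyperfilter ℕ) (𝓝 g) := by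
    intro t
    by_cases ht : t ∈ Icc (0 : ℝ) 1
    · obtain ⟨g, hg, hle⟩ := M.isCompact_densities.ultrafilter_le_nhds
        ((hyperfilter ℕ).map fun n => ρ n t)
        (le_principal_iff.2 (Filter.mem_map.2 (Filter.univ_mem' (hmem t ht))))
      exact ⟨g, fun _ => ⟨hg, hle⟩⟩
    · exact ⟨0, fun h => absurd h ht⟩
  choose γ hγ using hlim
  have h0mem : (0 : ℝ) ∈ Icc (0 : ℝ) 1 := left_mem_Icc.2 zero_le_one
  have h1mem : (1 : ℝ) ∈ Icc (0 : ℝ) 1 := right_mem_Icc.2 zero_le_one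
  have hγ0 : γ 0 = σ := by
    have := (hγ 0 h0mem).2
    simp only [h0] at this
    exact tendsto_nhds_unique this tendsto_const_nhds
  have hγ1 : γ 1 = τ := by
    have := (hγ 1 h1mem).2
    simp only [h1] at this
    exact tendsto_nhds_unique this tendsto_const_nhds
  have hAlim : Tendsto (fun n : ℕ => w ^ 2 + 1 / ((n : ℝ) + 1)) (hyperfilter ℕ) (𝓝 (w ^ 2)) := by
    have := (tendsto_one_div_add_atTop_nhds_zero_nat (𝕜 := ℝ)).const_add (w ^ 2)
    rw [add_zero] at this
    exact this.mono_left Nat.hyperfilter_le_atTop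
  have hWlim : ∀ s ∈ Icc (0 : ℝ) 1, ∀ t ∈ Icc (0 : ℝ) 1,
      Tendsto (fun n => (M.W (ρ n s) (ρ n t)).toReal) (hyperfilter ℕ)
        (𝓝 (M.W (γ s) (γ t)).toReal) := fun s hs t ht =>
    tendsto_toReal_W (hmem s hs) (hmem t ht) (hγ s hs).1 (hγ t ht).1 (hγ s hs).2 (hγ t ht).2
  have hspeed : ∀ s ∈ Icc (0 : ℝ) 1, ∀ t ∈ Icc (0 : ℝ) 1, s ≤ t →
      (M.W (γ s) (γ t)).toReal = (t - s) * w := by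
    intro s hs t ht hst
    have hb := fun n => (hf n).chord_bounds (by positivity) (hA n) hs.1 hst ht.2
    have hin : (M.W (γ s) (γ t)).toReal ^ 2 ≤ (t - s) * w ^ 2 :=
      le_of_tendsto_of_tendsto' ((hWlim s hs t ht).pow 2) (hAlim.const_mul _)
        fun n => (hb n).1
    have hout : (t - s) * ((M.W (γ 0) (γ s)).toReal + (M.W (γ t) (γ 1)).toReal) ^ 2 +
        (1 - (t - s)) * (M.W (γ s) (γ t)).toReal ^ 2 ≤ (t - s) * (1 - (t - s)) * w ^ 2 :=
      le_of_tendsto_of_tendsto'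
        (((((hWlim 0 h0mem s hs).add (hWlim t ht 1 h1mem)).pow 2).const_mul _).add
          (((hWlim s hs t ht).pow 2).const_mul _)) (hAlim.const_mul _) fun n => (hb n).2
    have htri : w ≤ (M.W (γ 0) (γ s)).toReal + (M.W (γ t) (γ 1)).toReal +
        (M.W (γ s) (γ t)).toReal := by
      have t1 := toReal_W_triangle (hγ 0 h0mem).1 (hγ s hs).1 (hγ 1 h1mem).1
      have t2 := toReal_W_triangle (hγ s hs).1 (hγ t ht).1 (hγ 1 h1mem).1
      rw [hγ0, hγ1, ← hw] at t1
      rw [hγ1] at t2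
      rw [hγ0, hγ1]
      linarith
    exact eq_mul_of_chord_bounds (sub_nonneg.2 hst) (by linarith [hs.1, ht.2]) hw0
      ENNReal.toReal_nonneg hin hout htri
  refine ⟨γ, ⟨fun t ht => (hγ t ht).1, ?_⟩, hγ0, hγ1⟩
  have hle : ∀ s ∈ Icc (0 : ℝ) 1, ∀ t ∈ Icc (0 : ℝ) 1, s ≤ t →
      M.W (γ s) (γ t) = ENNReal.ofReal |s - t| * M.W (γ 0) (γ 1) := by
    intro s hs t ht hst
    rw [← ENNReal.ofReal_toReal (W_ne_top (hγ s hs).1 (hγ t ht).1), hspeed s hs t ht hst,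
      hγ0, hγ1, ENNReal.ofReal_mul (sub_nonneg.2 hst), hw,
      ENNReal.ofReal_toReal (W_ne_top hσ hτ), abs_sub_comm, abs_of_nonneg (sub_nonneg.2 hst)]
  intro s hs t ht
  rcases le_total s t with hst | hst
  · exact hle s hs t ht hst
  · rw [W_comm, abs_sub_comm]
    exact hle t ht s hs hst

/-! ### Entropy and the diameter bound -/

/-- Jensen's inequality for `r log r`, through its tangent line `r - 1` at `1`. -/
theorem entropy_nonneg {ρ : X → ℝ} (hρ : ρ ∈ M.densities) : 0 ≤ M.entropy ρ := by
  have h : ∑ x, M.pi x * (ρ x - 1) = 0 := by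
    simp only [mul_sub, mul_one, Finset.sum_sub_distrib, hρ.2, M.pi_sum, sub_self]
  rw [← h]
  exact Finset.sum_le_sum fun x _ =>
    mul_le_mul_of_nonneg_left (Real.self_sub_one_le_mul_log (hρ.1 x)) (M.pi_nonneg x)

theorem diracDensity_of_ne {x y : X} (h : y ≠ x) : M.diracDensity x y = 0 := by
  simp [diracDensity, h]

theorem diracDensity_self (x : X) : M.diracDensity x x = 1 / M.pi x := by
  simp [diracDensity]

theorem diracDensity_mem_densities (x : X) : M.diracDensity x ∈ M.densities := by
  refine ⟨fun y => indicator_nonneg (fun _ _ => one_div_nonneg.2 (M.pi_nonneg x)) y, ?_⟩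
  rw [Finset.sum_eq_single x (fun y _ hy => by rw [diracDensity_of_ne hy, mul_zero]) (by simp),
    diracDensity_self, mul_one_div_cancel (pi_pos x).ne']

theorem entropy_diracDensity (x : X) : M.entropy (M.diracDensity x) = -Real.log (M.pi x) := by
  rw [entropy, Finset.sum_eq_single x
    (fun y _ hy => by rw [diracDensity_of_ne hy, zero_mul, mul_zero]) (by simp),
    diracDensity_self, ← mul_assoc, mul_one_div_cancel (pi_pos x).ne', one_mul, one_div,
    Real.log_inv]

/-- Convexity of the entropy along a geodesic, at its midpoint. -/
theorem dW_le {κ : ℝ} (hκ : 0 < κ) (hRic : M.RicciBoundedBelow κ) (x y : X) :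
    M.dW x y ≤
      ENNReal.ofReal (2 * √((-Real.log (M.pi x) - Real.log (M.pi y)) / κ)) := by
  have hx := M.diracDensity_mem_densities x
  have hy := M.diracDensity_mem_densities y
  obtain ⟨γ, hγ, h0, h1⟩ := exists_isConstantSpeedGeodesic hx hy
  have hmem : (1 / 2 : ℝ) ∈ Icc (0 : ℝ) 1 := by constructor <;> norm_num
  have hconv := hRic γ hγ (1 / 2) hmem
  have hpos := entropy_nonneg (hγ.1 _ hmem)
  rw [h0, h1, entropy_diracDensity, entropy_diracDensity] at hconv
  rw [dW, ← ENNReal.ofReal_toReal (W_ne_top hx hy)]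
  refine ENNReal.ofReal_le_ofReal ?_
  have hsq : ((M.W (M.diracDensity x) (M.diracDensity y)).toReal / 2) ^ 2 ≤
      (-Real.log (M.pi x) - Real.log (M.pi y)) / κ := by
    rw [le_div_iff₀ hκ]
    linarith
  linarith [Real.le_sqrt_of_sq_le hsq]

theorem piMin_pos (M : MarkovTriple X) [Nonempty X] : 0 < M.piMin := by
  obtain ⟨x, hx⟩ := exists_eq_ciInf_of_finite (f := M.pi)
  rw [piMin, ← hx]
  exact pi_pos x

theorem piMin_le (x : X) : M.piMin ≤ M.pi x :=
  ciInf_le (Set.finite_range M.pi).bddBelow x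

end MarkovTriple

theorem mainTheorem11 {X : Type*} [Fintype X] (M : MarkovTriple X) (κ : ℝ) (hκ : 0 < κ)
    (hRic : M.RicciBoundedBelow κ) :
    (∀ x y : X, M.dW x y ≤
      ENNReal.ofReal (2 * Real.sqrt ((-Real.log (M.pi x) - Real.log (M.pi y)) / κ))) ∧
    M.diamW ≤ ENNReal.ofReal (2 * Real.sqrt (-2 * Real.log M.piMin / κ)) := by
  refine ⟨fun x y => MarkovTriple.dW_le hκ hRic x y, iSup_le fun x => iSup_le fun y => ?_⟩
  have : Nonempty X := ⟨x⟩
  have hx := Real.log_le_log M.piMin_pos (M.piMin_le x)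
  have hy := Real.log_le_log M.piMin_pos (M.piMin_le y)
  refine (MarkovTriple.dW_le hκ hRic x y).trans (ENNReal.ofReal_le_ofReal ?_)
  gcongr
  linarith
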